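/- Let $\alpha,\beta$ be real numbers with $0<\alpha\le\frac12$ and $1\le\beta<\infty$. Let $\mathcal H=\ell^2(\mathbb Z^2)$ with its standard orthonormal basis $\{e_{x,y}\}$, let $M_{m,n}$ be the translation operators on $\mathcal H$, $M_{m,n}e_{x,y}=e_{x+m,y+n}$, and let $\check{\mathcal H}^{\alpha,\beta}$ be the closed linear span of the $e_{x,y}$ with $-\alpha x+y\ge 0$ or $-\beta x+y\le 0$. Let $\check P$ be the orthogonal projection of $\mathcal H$ onto $\check{\mathcal H}^{\alpha,\beta}$, and let $\check{\mathcal T}^{\alpha,\beta}$ be the $C^*$-subalgebra of $B(\check{\mathcal H}^{\alpha,\beta})$ generated by the operators $\check P M_{m,n}\check P$, $(m,n)\in\mathbb Z^2$. Let $\check{\mathcal C}^{\alpha,\beta}$ be the commutator ideal of $\check{\mathcal T}^{\alpha,\beta}$, i.e. its closed two-sided ideal generated by all commutators. Put $\check{\mathcal P}_{m,n}=\check P M_{m,n}\check P M_{-m,-n}\check P$ and $$\check A=\check{\mathcal P}_{0,1}+\check P M_{1,1}\check P\,(1-\check{\mathcal P}_{-1,0})+\check P M_{1,0}\check P\,(\check{\mathcal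 P}_{-1,0}-\check{\mathcal P}_{0,1}),$$ as an operator on $\check{\mathcal H}^{\alpha,\beta}$. Then $\check A\in\check{\mathcal T}^{\alpha,\beta}$, and $$\check A=\check{\mathcal P}_{0,1}+M_{1,1}(1-\check{\mathcal P}_{-1,0})+M_{1,0}(\check{\mathcal P}_{-1,0}-\check{\mathcal P}_{0,1})$$ (the compressions in the definition can be omitted). The operator $\check A$ is surjective and Fredholm, and its index $\dim\operatorname{Ker}\check A-\dim\operatorname{Coker}\check A$ is $1$. Its kernel is: 1. $\mathbb C(e_{-3,-1}-e_{-2,-1})$ if $\alpha=\frac12$ and $\beta=1$; 2. $\mathbb C(e_{-2,0}-e_{-1,0})$ if $0<\alpha<\frac12$ and $\beta=1$; 3. $\mathbb C(e_{-1,0}-e_{0,0})$ if $\alpha=\frac12$ and $1<\beta<\infty$; 4. $\mathbb C(e_{-1,0}-e_{0,0})$ if $0<\alpha<\frac12$ and $1<\beta<\infty$. Moreover, $\check A-1\in\check{\mathcal C}^{\alpha,\beta}$. -/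

import Mathlib

noncomputable section

namespace ConcaveCorner

/-- The Hilbert space `ℓ²(ℤ²)`. -/
def H : Type := lp (fun _ : ℤ × ℤ => ℂ) 2

instance : NormedAddCommGroup H :=
  inferInstanceAs (NormedAddCommGroup (lp (fun _ : ℤ × ℤ => ℂ) 2))

instance : InnerProductSpace ℂ H :=
  inferInstanceAs (InnerProductSpace ℂ (lp (fun _ : ℤ × ℤ => ℂ) 2))

instance : CompleteSpace H :=
  inferInstanceAs (CompleteSpace (lp (fun _ : ℤ × ℤ => ℂ) 2))

/-- The standard basis vector `e_{m,n}` of `ℓ²(ℤ²)`. -/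
def e (m n : ℤ) : H := lp.single (E := fun _ : ℤ × ℤ => ℂ) 2 (m, n) 1

theorem memlp_translate (m n : ℤ) (φ : lp (fun _ : ℤ × ℤ => ℂ) 2) :
    Memℓp (fun p : ℤ × ℤ => (φ (p.1 - m, p.2 - n) : ℂ)) 2 := by
  have h := (lp.memℓp φ).summable (by norm_num)
  refine memℓp_gen ?_
  exact (Equiv.subRight ((m, n) : ℤ × ℤ)).summable_iff.2 h

/-- The translation `(M_{m,n} φ)(k, l) = φ(k - m, l - n)`, as a linear isometry of `ℓ²(ℤ²)`. -/
def translationIsometry (m n : ℤ) :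
    lp (fun _ : ℤ × ℤ => ℂ) 2 →ₗᵢ[ℂ] lp (fun _ : ℤ × ℤ => ℂ) 2 where
  toFun φ := ⟨fun p => φ (p.1 - m, p.2 - n), memlp_translate m n φ⟩
  map_add' _ _ := rfl
  map_smul' _ _ := rfl
  norm_map' φ := by
    rw [lp.norm_eq_tsum_rpow (by norm_num), lp.norm_eq_tsum_rpow (by norm_num) φ]
    congr 1
    exact (Equiv.subRight ((m, n) : ℤ × ℤ)).tsum_eq (fun p => ‖φ p‖ ^ (2 : ENNReal).toReal)

/-- The translation operator `M_{m,n}` on `ℓ²(ℤ²)`. -/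
def M (m n : ℤ) : H →L[ℂ] H := (translationIsometry m n).toContinuousLinearMap

/-- The lattice points of the concave corner: the union of the half-planes
`-α x + y ≥ 0` and `-β x + y ≤ 0`. -/
def corner (α β : ℝ) : Set (ℤ × ℤ) :=
  {p | 0 ≤ -α * (p.1 : ℝ) + (p.2 : ℝ) ∨ -β * (p.1 : ℝ) + (p.2 : ℝ) ≤ 0}

/-- The closed subspace of `ℓ²(ℤ²)` spanned by the `e_{x,y}` with `(x, y)` in the concave corner. -/
def cornerSpace (α β : ℝ) : Submodule ℂ H :=
  (Submodule.span ℂ {v : H | ∃ p ∈ corner α β, v = e p.1 p.2}).topologicalClosure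

instance (α β : ℝ) : CompleteSpace (cornerSpace α β) :=
  inferInstanceAs (CompleteSpace
    (Submodule.span ℂ {v : H | ∃ p ∈ corner α β, v = e p.1 p.2}).topologicalClosure)

/-- The bounded operators on the Hilbert space of the concave corner. -/
abbrev Op (α β : ℝ) : Type := cornerSpace α β →L[ℂ] cornerSpace α β

instance (α β : ℝ) : IsTopologicalRing (Op α β) :=
  @NonUnitalSeminormedRing.toIsTopologicalRing (Op α β)
    (@NonUnitalNormedRing.toNonUnitalSeminormedRing _
      (@NormedRing.toNonUnitalNormedRing _ ContinuousLinearMap.toNormedRing))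

instance (α β : ℝ) : ContinuousStar (Op α β) :=
  ⟨(ContinuousLinearMap.adjoint (𝕜 := ℂ) (E := cornerSpace α β)
    (F := cornerSpace α β)).continuous⟩

/-- The Toeplitz operator `P M_{m,n} P`, as an operator on the range of the orthogonal
projection `P` onto the Hilbert space of the concave corner. -/
def T (α β : ℝ) (m n : ℤ) : Op α β :=
  (cornerSpace α β).orthogonalProjectionOnto ∘L M m n ∘L (cornerSpace α β).subtypeL

/-- The concave corner Toeplitz algebra: the `C⋆`-algebra generated by the `P M_{m,n} P`. -/
def toeplitzAlgebra (α β : ℝ) : StarSubalgebra ℂ (Op α β) :=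
  (StarAlgebra.adjoin ℂ {S : Op α β | ∃ m n : ℤ, S = T α β m n}).topologicalClosure

/-- The commutator ideal of the Toeplitz algebra: the closed two-sided ideal generated by all
commutators of elements of the algebra. -/
def commutatorIdeal (α β : ℝ) : Set (toeplitzAlgebra α β) :=
  closure (TwoSidedIdeal.span
    {S : toeplitzAlgebra α β | ∃ X Y : toeplitzAlgebra α β, S = X * Y - Y * X} :
      Set (toeplitzAlgebra α β))

/-- `𝒫_{m,n} = P M_{m,n} P M_{-m,-n} P`. -/
def proj (α β : ℝ) (m n : ℤ) : Op α β := T α β m n * T α β (-m) (-n)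

/-- The operator
`A = 𝒫_{0,1} + P M_{1,1} P (1 - 𝒫_{-1,0}) + P M_{1,0} P (𝒫_{-1,0} - 𝒫_{0,1})`. -/
def A (α β : ℝ) : Op α β :=
  proj α β 0 1 + T α β 1 1 * (1 - proj α β (-1) 0)
    + T α β 1 0 * (proj α β (-1) 0 - proj α β 0 1)

/-- The Fredholm index `dim Ker S - dim Coker S` (meaningful for Fredholm operators `S`). -/
def index {α β : ℝ} (S : Op α β) : ℤ :=
  (Module.finrank ℂ S.ker : ℤ) - (Module.finrank ℂ (cornerSpace α β ⧸ S.range) : ℤ)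

/-- The kernel of an operator on the concave corner, as a subspace of `ℓ²(ℤ²)`. -/
def kernel {α β : ℝ} (S : Op α β) : Submodule ℂ H :=
  S.ker.map (cornerSpace α β).subtype

end ConcaveCorner

end

noncomputable section

namespace ConcaveCorner

/-! The operator is induced by a self-map of the corner. A point whose lower neighbour is in the
corner is fixed; a point whose right neighbour is missing moves by `(1, 1)`; every other point moves
by `(1, 0)`. These classes partition the corner (`add_one_left_mem`), and no move leaves it.

The map is onto and injective except at one point `q`, hit both by itself and by its left neighbour
(`coord_A`). So the kernel is spanned by `e_{q-(1,0)} - e_q`, and `A` times its adjoint is the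
identity plus the projection onto `e_q`, which gives surjectivity. The slopes enter the answer only
through the position of `q`, an integer inequality problem.

For the ideal, `A - 1` is a combination of `1 - 𝒫_{-1,0}` and `1 - 𝒫_{0,1}`, each a multiple of a
commutator. -/

theorem mem_corner {α β : ℝ} {x y : ℤ} :
    (x, y) ∈ corner α β ↔ α * x ≤ y ∨ (y : ℝ) ≤ β * x := by
  simp only [corner, Set.mem_ofPred_eq]
  constructor
  · rintro (h | h)
    · left; linarith
    · right; linarith
  · rintro (h | h)
    · left; linarith
    · right; linarith

/-- The lattice points at which the map of basis vectors induced by `A` is two-to-one: such a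
point is fixed, and it is also the image of its left neighbour. -/
def IsDoublePoint (α β : ℝ) (q : ℤ × ℤ) : Prop :=
  q ∈ corner α β ∧ (q.1, q.2 - 1) ∈ corner α β ∧ (q.1 - 1, q.2) ∈ corner α β ∧
    (q.1 - 1, q.2 - 1) ∉ corner α β

/-! ### Lattice geometry of the corner and the position of the double point -/

section Combinatorics

variable {α β : ℝ} {x y : ℤ}

/-- The step `(1, 1)` from `(x, y - 1)` preserves both half-planes because `α ≤ 1 ≤ β`. Consequently
no point is both fixed and moved diagonally. -/
theorem add_one_left_mem (hα : 0 < α) (hα' : α ≤ 1 / 2) (hβ : 1 ≤ β) (h : (x, y) ∈ corner α β)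
    (h' : (x, y - 1) ∈ corner α β) : (x + 1, y) ∈ corner α β := by
  simp only [mem_corner] at *
  push_cast at *
  rcases h with h | h <;> rcases h' with h' | h'
  · left; linarith
  · right; linarith
  · left; linarith
  · right; linarith

theorem above_of_add_one_left_notMem (hβ : 1 ≤ β) (h : (x, y) ∈ corner α β)
    (h' : (x + 1, y) ∉ corner α β) : α * x ≤ y := by
  simp only [mem_corner, not_or] at *
  push_cast at *
  rcases h with h | h
  · exact h
  · linarith

theorem above_of_sub_one_right_notMem (h : (x, y) ∈ corner α β)
    (h' : (x, y - 1) ∉ corner α β) : α * x ≤ y := by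
  simp only [mem_corner, not_or] at *
  push_cast at *
  rcases h with h | h
  · exact h
  · linarith

theorem mem_corner_of_above (h : α * x ≤ y) : (x, y) ∈ corner α β := mem_corner.2 (Or.inl h)

theorem add_one_add_one_mem (hα' : α ≤ 1 / 2) (hβ : 1 ≤ β) (h : (x, y) ∈ corner α β)
    (h' : (x + 1, y) ∉ corner α β) : (x + 1, y + 1) ∈ corner α β := by
  have := above_of_add_one_left_notMem hβ h h'
  apply mem_corner_of_above
  push_cast
  linarith

theorem sub_one_left_mem (hα : 0 < α) (h : α * x ≤ y) : (x - 1, y) ∈ corner α β := by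
  apply mem_corner_of_above
  push_cast
  linarith

theorem add_one_right_mem (h : α * x ≤ y) : (x, y + 1) ∈ corner α β := by
  apply mem_corner_of_above
  push_cast
  linarith

/-- Since `(u - 1, v - 1)` is outside, it lies strictly between the two lines, so `u < 1`. If `u ≤
-1`, the gap `β - α > 1/2` between the slopes leaves only `(-1, 0)`, which would need `β ≤ 1`. -/
theorem isDoublePoint_iff_of_lt (hα : 0 < α) (hα' : α ≤ 1 / 2) (hβ : 1 < β) (q : ℤ × ℤ) :
    IsDoublePoint α β q ↔ q = (0, 0) := by
  obtain ⟨u, v⟩ := q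
  simp only [IsDoublePoint, mem_corner, Prod.mk.injEq]
  constructor
  · rintro ⟨h1, h2, h3, h4⟩
    push_cast at *
    rw [not_or] at h4
    obtain ⟨h4, h5⟩ := h4
    push Not at h4 h5
    have hv1 : α * (u - 1) ≤ v := by rcases h3 with h | h <;> linarith
    have hv2 : (v - 1 : ℝ) ≤ β * u := by rcases h2 with h | h <;> linarith
    have hu : (u : ℝ) - 1 < 0 := by nlinarith
    have hu' : u < 1 := by exact_mod_cast (by linarith : (u : ℝ) < 1)
    have hu0 : u = 0 := by
      by_contra hne
      have hu1 : u ≤ -1 := by omega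
      have hu1' : (u : ℝ) ≤ -1 := by exact_mod_cast hu1
      rcases h1 with h1 | h1
      · have hb : (β - α) * (-u) ≤ 1 := by linarith
        have hu2 : u = -1 := by
          by_contra hne'
          have : u ≤ -2 := by omega
          have : (u : ℝ) ≤ -2 := by exact_mod_cast this
          nlinarith
        subst hu2
        push_cast at *
        have h6 : (v : ℝ) < 1 := by linarith
        have h7 : (-1 : ℝ) < v := by linarith
        have h6' : v < 1 := by exact_mod_cast h6
        have h7' : -1 < v := by exact_mod_cast h7
        have : v = 0 := by omega
        subst this
        push_cast at *
        linarith
      · nlinarith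
    subst hu0
    refine ⟨rfl, ?_⟩
    push_cast at *
    have h6' : v < 1 := by exact_mod_cast (by linarith : (v : ℝ) < 1)
    have h7' : -1 < v := by exact_mod_cast (by linarith : (-1 : ℝ) < v)
    omega
  · rintro ⟨rfl, rfl⟩
    push_cast
    refine ⟨Or.inl (by linarith), Or.inr (by linarith), Or.inl (by linarith), ?_⟩
    rintro (h | h) <;> linarith

/-- With `β = 1` integrality forces `v = u + 1`; the inequalities in `α` then give `-2 < u < 0`, the
lower bound using `1 - α > 1/2`. -/
theorem isDoublePoint_one_iff_of_lt (hα : 0 < α) (hα' : α < 1 / 2) (q : ℤ × ℤ) :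
    IsDoublePoint α 1 q ↔ q = (-1, 0) := by
  obtain ⟨u, v⟩ := q
  simp only [IsDoublePoint, mem_corner, Prod.mk.injEq]
  constructor
  · rintro ⟨h1, h2, h3, h4⟩
    push_cast at *
    rw [not_or] at h4
    obtain ⟨h4, h5⟩ := h4
    push Not at h4 h5
    have hv1 : α * (u - 1) ≤ v := by rcases h3 with h | h <;> linarith
    have hv2 : (v - 1 : ℝ) ≤ 1 * u := by rcases h2 with h | h <;> linarith
    have hv : v = u + 1 := by
      have a : v ≤ u + 1 := by exact_mod_cast (by linarith : (v : ℝ) ≤ u + 1)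
      have b : u < v := by exact_mod_cast (by linarith : (u : ℝ) < v)
      omega
    subst hv
    push_cast at *
    have h1 : α * u ≤ u + 1 := by rcases h1 with h | h <;> linarith
    have a : u < 0 := by
      by_contra hu
      have : (0 : ℝ) ≤ u := by exact_mod_cast (by omega : 0 ≤ u)
      nlinarith
    have b : -2 < u := by
      by_contra hu
      have : (u : ℝ) ≤ -2 := by exact_mod_cast (by omega : u ≤ -2)
      nlinarith
    omega
  · rintro ⟨rfl, rfl⟩
    push_cast
    refine ⟨Or.inl (by linarith), Or.inr (by linarith), Or.inl (by linarith), ?_⟩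
    rintro (h | h) <;> linarith

theorem isDoublePoint_half_one_iff (q : ℤ × ℤ) :
    IsDoublePoint (1 / 2) 1 q ↔ q = (-2, -1) := by
  obtain ⟨u, v⟩ := q
  simp only [IsDoublePoint, mem_corner, Prod.mk.injEq]
  constructor
  · rintro ⟨h1, h2, h3, h4⟩
    push_cast at *
    rw [not_or] at h4
    obtain ⟨h4, h5⟩ := h4
    push Not at h4 h5
    have hv1 : 1 / 2 * ((u : ℝ) - 1) ≤ v := by rcases h3 with h | h <;> linarith
    have hv2 : (v - 1 : ℝ) ≤ 1 * u := by rcases h2 with h | h <;> linarith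
    have h1 : 1 / 2 * (u : ℝ) ≤ v := by rcases h1 with h | h <;> linarith
    have a : v ≤ u + 1 := by exact_mod_cast (by linarith : (v : ℝ) ≤ u + 1)
    have b : u < v := by exact_mod_cast (by linarith : (u : ℝ) < v)
    have c : u ≤ 2 * v := by exact_mod_cast (by linarith : (u : ℝ) ≤ 2 * v)
    have d : 2 * (v - 1) < u - 1 := by
      exact_mod_cast (by linarith : 2 * ((v : ℝ) - 1) < u - 1)
    omega
  · rintro ⟨rfl, rfl⟩
    push_cast
    norm_num

end Combinatorics

/-! ### Coordinates on `ℓ²(ℤ²)` and the projection onto the corner space -/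

/-- The coordinate functional `f ↦ f(p)` on `ℓ²(ℤ²)`. -/
def coord (p : ℤ × ℤ) : H →L[ℂ] ℂ := lp.evalCLM ℂ (fun _ : ℤ × ℤ => ℂ) 2 p

theorem ext_coord {f g : H} (h : ∀ p, coord p f = coord p g) : f = g :=
  lp.ext (funext h)

theorem coord_M (m n : ℤ) (p : ℤ × ℤ) (f : H) :
    coord p (M m n f) = coord (p.1 - m, p.2 - n) f := rfl

open Classical in
theorem coord_e (m n : ℤ) (p : ℤ × ℤ) : coord p (e m n) = if p = (m, n) then 1 else 0 := by
  change (lp.single (E := fun _ : ℤ × ℤ => ℂ) 2 (m, n) 1 : ∀ _, ℂ) p = _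
  rw [lp.single_apply]
  by_cases h : p = (m, n)
  · subst h; simp
  · simp [h]

theorem hasSum_coord_smul_e (f : H) : HasSum (fun p : ℤ × ℤ => coord p f • e p.1 p.2) f := by
  have h := lp.hasSum_single (E := fun _ : ℤ × ℤ => ℂ) (p := 2) (by norm_num) f
  have heq : (fun p : ℤ × ℤ => coord p f • e p.1 p.2) =
      fun p => lp.single (E := fun _ : ℤ × ℤ => ℂ) 2 p (coord p f) := by
    funext p
    change coord p f • lp.single (E := fun _ : ℤ × ℤ => ℂ) 2 p 1 = _
    rw [← lp.single_smul]
    simp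
  rw [heq]
  exact h

theorem inner_eq_tsum_coord (f g : H) :
    inner ℂ f g = ∑' p, inner ℂ (coord p f) (coord p g) := lp.inner_eq_tsum (𝕜 := ℂ) f g

theorem e_mem_cornerSpace {α β : ℝ} {m n : ℤ} (h : (m, n) ∈ corner α β) :
    e m n ∈ cornerSpace α β :=
  Submodule.le_topologicalClosure _ (Submodule.subset_span ⟨(m, n), h, rfl⟩)

theorem mem_cornerSpace {α β : ℝ} {f : H} :
    f ∈ cornerSpace α β ↔ ∀ p ∉ corner α β, coord p f = 0 := by
  constructor
  · intro hf p hp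
    have hle : cornerSpace α β ≤ (coord p).ker := by
      refine Submodule.topologicalClosure_minimal _ ?_ (coord p).isClosed_ker
      rw [Submodule.span_le]
      rintro v ⟨q, hq, rfl⟩
      have hpq : p ≠ (q.1, q.2) := fun h => hp (h ▸ hq)
      simp [coord_e, hpq]
    exact hle hf
  · intro h
    refine (Submodule.isClosed_topologicalClosure _).mem_of_tendsto (hasSum_coord_smul_e f)
      (Filter.Eventually.of_forall fun s => Submodule.sum_mem _ fun p _ => ?_)
    by_cases hp : p ∈ corner α β
    · exact Submodule.smul_mem _ _ (e_mem_cornerSpace hp)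
    · rw [h p hp, zero_smul]
      exact Submodule.zero_mem _

open Classical in
/-- The restriction of a square-summable function to a set. -/
def restrict (s : Set (ℤ × ℤ)) (f : H) : H :=
  (⟨fun p => if p ∈ s then coord p f else 0, by
    have h := lp.memℓp (E := fun _ : ℤ × ℤ => ℂ) (p := 2) f
    refine memℓp_gen ((h.summable (by norm_num)).of_nonneg_of_le (fun p => by positivity)
      fun p => ?_)
    split_ifs
    · exact le_rfl
    · simp⟩ : lp (fun _ : ℤ × ℤ => ℂ) 2)

open Classical in
theorem coord_restrict (s : Set (ℤ × ℤ)) (f : H) (p : ℤ × ℤ) :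
    coord p (restrict s f) = if p ∈ s then coord p f else 0 := rfl

open Classical in
theorem coord_orthogonalProjection {α β : ℝ} (f : H) (p : ℤ × ℤ) :
    coord p ((cornerSpace α β).orthogonalProjectionOnto f : H) =
      if p ∈ corner α β then coord p f else 0 := by
  have h : (cornerSpace α β).starProjection f = restrict (corner α β) f := by
    refine Submodule.eq_starProjection_of_mem_of_inner_eq_zero ?_ ?_
    · refine mem_cornerSpace.2 fun p hp => ?_
      rw [coord_restrict, if_neg hp]
    · intro g hg
      rw [inner_eq_tsum_coord]
      refine (tsum_congr fun p => ?_).trans tsum_zero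
      rw [map_sub, coord_restrict]
      split_ifs with hp
      · simp
      · simp [mem_cornerSpace.1 hg p hp]
  change coord p ((cornerSpace α β).starProjection f) = _
  rw [h, coord_restrict]

/-! ### Toeplitz operators in coordinates -/

section Operators

variable {α β : ℝ}

theorem coord_of_notMem (f : cornerSpace α β) {p : ℤ × ℤ} (hp : p ∉ corner α β) :
    coord p (f : H) = 0 := mem_cornerSpace.1 f.2 p hp

theorem ext_corner {f g : cornerSpace α β}
    (h : ∀ p ∈ corner α β, coord p (f : H) = coord p (g : H)) : f = g := by
  refine Subtype.ext (ext_coord fun p => ?_)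
  by_cases hp : p ∈ corner α β
  · exact h p hp
  · rw [coord_of_notMem f hp, coord_of_notMem g hp]

open Classical in
theorem coord_T (m n : ℤ) (f : cornerSpace α β) (p : ℤ × ℤ) :
    coord p (T α β m n f : H) =
      if p ∈ corner α β then coord (p.1 - m, p.2 - n) (f : H) else 0 :=
  coord_orthogonalProjection _ _

open Classical in
theorem coord_proj (m n : ℤ) (f : cornerSpace α β) (p : ℤ × ℤ) :
    coord p (proj α β m n f : H) =
      if p ∈ corner α β ∧ (p.1 - m, p.2 - n) ∈ corner α β then coord p (f : H) else 0 := by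
  change coord p (T α β m n (T α β (-m) (-n) f) : H) = _
  simp only [coord_T]
  by_cases h : p ∈ corner α β <;> by_cases h' : (p.1 - m, p.2 - n) ∈ corner α β <;> simp [h, h']

theorem coord_add (f g : cornerSpace α β) (p : ℤ × ℤ) :
    coord p ((f + g : cornerSpace α β) : H) = coord p (f : H) + coord p (g : H) :=
  map_add (coord p) _ _

theorem coord_sub (f g : cornerSpace α β) (p : ℤ × ℤ) :
    coord p ((f - g : cornerSpace α β) : H) = coord p (f : H) - coord p (g : H) :=
  map_sub (coord p) _ _

open Classical in
theorem coord_one_sub_proj (m n : ℤ) (f : cornerSpace α β) (p : ℤ × ℤ) :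
    coord p ((1 - proj α β m n) f : H) =
      if p ∈ corner α β ∧ (p.1 - m, p.2 - n) ∉ corner α β then coord p (f : H) else 0 := by
  change coord p ((f - proj α β m n f : cornerSpace α β) : H) = _
  rw [coord_sub, coord_proj]
  by_cases h : p ∈ corner α β
  · by_cases h' : (p.1 - m, p.2 - n) ∈ corner α β <;> simp [h, h']
  · simp [h, coord_of_notMem f h]

end Operators

/-! ### `A` and its adjoint in coordinates -/

section Formulas

variable {α β : ℝ}

open Classical in
theorem coord_projDiff (hα : 0 < α) (hα' : α ≤ 1 / 2) (hβ : 1 ≤ β) (f : cornerSpace α β)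
    (x y : ℤ) :
    coord (x, y) ((proj α β (-1) 0 - proj α β 0 1) f : H) =
      if (x, y) ∈ corner α β ∧ (x + 1, y) ∈ corner α β ∧ (x, y - 1) ∉ corner α β
        then coord (x, y) (f : H) else 0 := by
  change coord (x, y) ((proj α β (-1) 0 f - proj α β 0 1 f : cornerSpace α β) : H) = _
  rw [coord_sub, coord_proj, coord_proj]
  simp only [sub_neg_eq_add, sub_zero]
  by_cases h : (x, y) ∈ corner α β <;> by_cases h₁ : (x + 1, y) ∈ corner α β <;>
    by_cases h₂ : (x, y - 1) ∈ corner α β <;> simp [h, h₁, h₂]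
  -- The one case that would give coefficient `-1`; its exclusion says `𝒫_{0,1} ≤ 𝒫_{-1,0}`.
  exact absurd (add_one_left_mem hα hα' hβ h h₂) h₁

theorem A_apply (f : cornerSpace α β) :
    A α β f = proj α β 0 1 f + T α β 1 1 ((1 - proj α β (-1) 0) f)
      + T α β 1 0 ((proj α β (-1) 0 - proj α β 0 1) f) := rfl

theorem A_apply_eq_translations (hα : 0 < α) (hα' : α ≤ 1 / 2) (hβ : 1 ≤ β)
    (f : cornerSpace α β) :
    (A α β f : H) = (proj α β 0 1 f : H) + M 1 1 ((1 - proj α β (-1) 0) f : H)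
      + M 1 0 ((proj α β (-1) 0 - proj α β 0 1) f : H) := by
  refine ext_coord fun ⟨x, y⟩ => ?_
  rw [A_apply, coord_add, coord_add, coord_T, coord_T, map_add, map_add, coord_M, coord_M]
  by_cases h : (x, y) ∈ corner α β
  · simp only [h, if_true]
  · have h₁ : coord (x - 1, y - 1) ((1 - proj α β (-1) 0) f : H) = 0 := by
      rw [coord_one_sub_proj, if_neg]
      rintro ⟨h₁, h₂⟩
      refine h ?_
      simpa using add_one_add_one_mem hα' hβ h₁ (by simpa using h₂)
    have h₂ : coord (x - 1, y) ((proj α β (-1) 0 - proj α β 0 1) f : H) = 0 := by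
      rw [coord_projDiff hα hα' hβ, if_neg]
      rintro ⟨-, h₂, -⟩
      exact h (by simpa using h₂)
    simp only [h, if_false, sub_zero, h₁, h₂]

open Classical in
-- The sum of `f` over the preimages of `(x, y)`: the branches list those preimages, and only a
-- double point has two.
theorem coord_A (hα : 0 < α) (hα' : α ≤ 1 / 2) (hβ : 1 ≤ β) (f : cornerSpace α β) {x y : ℤ}
    (h : (x, y) ∈ corner α β) :
    coord (x, y) (A α β f : H) =
      if (x, y - 1) ∈ corner α β then
        coord (x, y) (f : H) + if IsDoublePoint α β (x, y) then coord (x - 1, y) (f : H) else 0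
      else if (x - 1, y - 1) ∈ corner α β then coord (x - 1, y - 1) (f : H)
      else coord (x - 1, y) (f : H) := by
  rw [A_apply, coord_add, coord_add, coord_T, coord_T, coord_proj]
  simp only [h, if_true, sub_zero, true_and, coord_one_sub_proj, coord_projDiff hα hα' hβ,
    sub_neg_eq_add, sub_add_cancel, IsDoublePoint]
  by_cases h₁ : (x, y - 1) ∈ corner α β
  · simp [h₁]
  · by_cases h₂ : (x - 1, y - 1) ∈ corner α β
    · simp [h₁, h₂]
    · have h₃ := sub_one_left_mem (β := β) hα (above_of_sub_one_right_notMem h h₁)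
      simp [h₁, h₂, h₃]

/-- The adjoint of `A`: a right inverse up to a rank one operator. -/
def adjA (α β : ℝ) : Op α β :=
  proj α β 0 1 + (1 - proj α β (-1) 0) * T α β (-1) (-1)
    + (proj α β (-1) 0 - proj α β 0 1) * T α β (-1) 0

theorem adjA_apply (f : cornerSpace α β) :
    adjA α β f = proj α β 0 1 f + (1 - proj α β (-1) 0) (T α β (-1) (-1) f)
      + (proj α β (-1) 0 - proj α β 0 1) (T α β (-1) 0 f) := rfl

open Classical in
theorem coord_adjA (hα : 0 < α) (hα' : α ≤ 1 / 2) (hβ : 1 ≤ β) (f : cornerSpace α β) {x y : ℤ}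
    (h : (x, y) ∈ corner α β) :
    coord (x, y) (adjA α β f : H) =
      if (x, y - 1) ∈ corner α β then coord (x, y) (f : H)
      else if (x + 1, y) ∈ corner α β then coord (x + 1, y) (f : H)
      else coord (x + 1, y + 1) (f : H) := by
  rw [adjA_apply, coord_add, coord_add, coord_projDiff hα hα' hβ, coord_one_sub_proj, coord_T,
    coord_T, coord_proj]
  simp only [h, if_true, sub_zero, true_and, sub_neg_eq_add]
  by_cases h₁ : (x, y - 1) ∈ corner α β
  · simp [h₁, add_one_left_mem hα hα' hβ h h₁]
  · by_cases h₂ : (x + 1, y) ∈ corner α β <;> simp [h₁, h₂]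

open Classical in
-- `adjA` copies the value at the image of each point back to that point, so the composite
-- multiplies each coordinate by its number of preimages.
theorem coord_A_adjA (hα : 0 < α) (hα' : α ≤ 1 / 2) (hβ : 1 ≤ β) (f : cornerSpace α β)
    {p : ℤ × ℤ} (h : p ∈ corner α β) :
    coord p (A α β (adjA α β f) : H) =
      coord p (f : H) + if IsDoublePoint α β p then coord p (f : H) else 0 := by
  obtain ⟨x, y⟩ := p
  rw [coord_A hα hα' hβ _ h]
  by_cases h₁ : (x, y - 1) ∈ corner α β
  · rw [if_pos h₁, coord_adjA hα hα' hβ f h, if_pos h₁]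
    split_ifs with h₂
    · obtain ⟨-, -, h₃, h₄⟩ := h₂
      rw [coord_adjA hα hα' hβ f h₃, if_neg h₄, if_pos (by simpa using h), sub_add_cancel]
    · rfl
  · have hD : ¬ IsDoublePoint α β (x, y) := fun hD => h₁ hD.2.1
    rw [if_neg h₁, if_neg hD, add_zero]
    split_ifs with h₂
    · have h₃ : (x - 1, y - 1 - 1) ∉ corner α β := fun h₃ =>
        h₁ (by simpa using add_one_left_mem hα hα' hβ h₂ h₃)
      rw [coord_adjA hα hα' hβ f h₂, if_neg h₃, if_neg (by simpa using h₁)]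
      simp only [sub_add_cancel]
    · have h₃ := sub_one_left_mem (β := β) hα (above_of_sub_one_right_notMem h h₁)
      rw [coord_adjA hα hα' hβ f h₃, if_neg h₂, if_pos (by simpa using h), sub_add_cancel]

end Formulas

/-! ### Surjectivity, kernel and index -/

section Index

variable {α β : ℝ} {u v : ℤ}

theorem surjective_A (hα : 0 < α) (hα' : α ≤ 1 / 2) (hβ : 1 ≤ β)
    (hq : ∀ q, IsDoublePoint α β q ↔ q = (u, v)) : Function.Surjective (A α β) := by
  classical
  intro g
  have huv : (u, v) ∈ corner α β := ((hq (u, v)).2 rfl).1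
  let d : cornerSpace α β := ⟨e u v, e_mem_cornerSpace huv⟩
  -- The composite doubles the coordinate at the double point, so that coordinate of `g` is halved
  -- beforehand.
  refine ⟨adjA α β (g - (coord (u, v) (g : H) / 2) • d), ext_corner fun p hp => ?_⟩
  have hd : coord p ((g - (coord (u, v) (g : H) / 2) • d : cornerSpace α β) : H) =
      coord p (g : H) - coord (u, v) (g : H) / 2 * if p = (u, v) then 1 else 0 := by
    rw [coord_sub, ← coord_e]
    exact congrArg _ (map_smul (coord p) _ _)
  rw [coord_A_adjA hα hα' hβ _ hp, hd]
  by_cases hpq : p = (u, v)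
  · rw [if_pos hpq, if_pos ((hq p).2 hpq), hpq]
    ring
  · rw [if_neg hpq, if_neg (mt (hq p).1 hpq)]
    ring

theorem kernel_A (hα : 0 < α) (hα' : α ≤ 1 / 2) (hβ : 1 ≤ β)
    (hq : ∀ q, IsDoublePoint α β q ↔ q = (u, v)) :
    kernel (A α β) = Submodule.span ℂ {e (u - 1) v - e u v} := by
  classical
  obtain ⟨h₁, h₂, h₃, h₄⟩ := (hq (u, v)).2 rfl
  simp only at h₁ h₂ h₃ h₄
  refine le_antisymm ?_ ?_
  · rintro _ ⟨f, hf, rfl⟩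
    have hf0 : A α β f = 0 := hf
    have hA : ∀ p, coord p (A α β f : H) = 0 := fun p => by
      rw [hf0]; exact map_zero (coord p)
    refine Submodule.mem_span_singleton.2 ⟨coord (u - 1, v) (f : H), ext_coord fun ⟨x, y⟩ => ?_⟩
    rw [map_smul, map_sub, coord_e, coord_e]
    change _ = coord (x, y) (f : H)
    have hsum : coord (u, v) (f : H) + coord (u - 1, v) (f : H) = 0 := by
      have := hA (u, v)
      rwa [coord_A hα hα' hβ f h₁, if_pos h₂, if_pos ((hq _).2 rfl)] at this
    by_cases ha : (x, y) = (u - 1, v)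
    · have hne : ((u - 1, v) : ℤ × ℤ) ≠ (u, v) := by simp
      rw [ha, if_pos rfl, if_neg hne]
      simp
    by_cases hb : (x, y) = (u, v)
    · have hne : ((u, v) : ℤ × ℤ) ≠ (u - 1, v) := by
        rw [Ne, Prod.mk.injEq]
        omega
      rw [hb, if_pos rfl, if_neg hne, smul_eq_mul]
      linear_combination -hsum
    rw [if_neg ha, if_neg hb, sub_zero, smul_zero]
    symm
    -- Any other point of the corner is the sole preimage of its image; evaluating `A f = 0` at that
    -- image, in each of the three classes, gives the vanishing.
    by_cases hc : (x, y) ∈ corner α β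
    · by_cases hc₁ : (x, y - 1) ∈ corner α β
      · have := hA (x, y)
        rwa [coord_A hα hα' hβ f hc, if_pos hc₁, if_neg (mt (hq _).1 hb), add_zero] at this
      · by_cases hc₂ : (x + 1, y) ∈ corner α β
        · have hD : ¬ IsDoublePoint α β (x + 1, y) := by
            rw [hq, Prod.mk.injEq]
            rintro ⟨rfl, rfl⟩
            exact ha (by simp)
          have hc₃ : (x + 1, y - 1) ∉ corner α β := fun hc₃ =>
            hD ⟨hc₂, hc₃, by simpa using hc, by simpa using hc₁⟩
          have := hA (x + 1, y)
          rwa [coord_A hα hα' hβ f hc₂, if_neg hc₃, if_neg (by simpa using hc₁),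
            add_sub_cancel_right] at this
        · have hc₃ := add_one_add_one_mem hα' hβ hc hc₂
          have := hA (x + 1, y + 1)
          rwa [coord_A hα hα' hβ f hc₃, if_neg (by simpa using hc₂), if_pos (by simpa using hc),
            add_sub_cancel_right, add_sub_cancel_right] at this
    · exact coord_of_notMem f hc
  · rw [Submodule.span_singleton_le_iff_mem]
    let d : cornerSpace α β :=
      ⟨e (u - 1) v - e u v, Submodule.sub_mem _ (e_mem_cornerSpace h₃) (e_mem_cornerSpace h₁)⟩
    refine ⟨d, ?_, rfl⟩
    change A α β d = 0
    have hd : ∀ p, coord p (d : H) =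
        (if p = (u - 1, v) then 1 else 0) - if p = (u, v) then 1 else 0 := fun p => by
      rw [← coord_e, ← coord_e]
      exact map_sub (coord p) _ _
    refine ext_corner fun ⟨x, y⟩ hp => ?_
    rw [coord_A hα hα' hβ d hp]
    refine Eq.trans ?_ (map_zero (coord (x, y))).symm
    simp only [hd, hq, Prod.mk.injEq]
    -- This excludes a diagonal move of `(u, v)`, which would add a term at `(u + 1, v + 1)`.
    have h₅ := add_one_left_mem hα hα' hβ h₁ h₂
    split_ifs <;> grind

theorem e_sub_e_ne_zero : e (u - 1) v - e u v ≠ 0 := by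
  classical
  intro h
  have hne : ((u, v) : ℤ × ℤ) ≠ (u - 1, v) := by
    rw [Ne, Prod.mk.injEq]
    omega
  have := congrArg (coord (u, v)) h
  rw [map_sub, coord_e, coord_e, if_neg hne, if_pos rfl, map_zero] at this
  norm_num at this

theorem finrank_ker_A (hα : 0 < α) (hα' : α ≤ 1 / 2) (hβ : 1 ≤ β)
    (hq : ∀ q, IsDoublePoint α β q ↔ q = (u, v)) : Module.finrank ℂ (A α β).ker = 1 := by
  rw [← Submodule.finrank_map_subtype_eq]
  change Module.finrank ℂ (kernel (A α β)) = 1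
  rw [kernel_A hα hα' hβ hq, finrank_span_singleton e_sub_e_ne_zero]

theorem isFredholm_of_surjective {S : Op α β} (hS : Function.Surjective S)
    (hker : FiniteDimensional ℂ S.ker) : S.IsFredholm where
  isStrictMap := (S.isOpenMap hS).isStrictMap S.continuous
  isClosed_range := by
    rw [LinearMap.range_eq_top.2 hS]
    exact isClosed_univ
  finite_ker := hker
  finite_coker := by
    rw [LinearMap.range_eq_top.2 hS]
    exact Submodule.CoFG.top
  closedComplemented_ker := Submodule.ClosedComplemented.of_finiteDimensional _

theorem index_of_surjective {S : Op α β} (hS : Function.Surjective S) :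
    index S = Module.finrank ℂ S.ker := by
  have : Module.finrank ℂ (cornerSpace α β ⧸ S.range) = 0 := by
    rw [LinearMap.range_eq_top.2 hS]
    exact Module.finrank_zero_of_subsingleton
  rw [index, this]
  simp

end Index

/-! ### Membership in the commutator ideal -/

section CommutatorIdeal

variable {α β : ℝ}

theorem T_mem_toeplitzAlgebra (m n : ℤ) : T α β m n ∈ toeplitzAlgebra α β :=
  StarSubalgebra.le_topologicalClosure _ (StarAlgebra.subset_adjoin _ _ ⟨m, n, rfl⟩)

theorem proj_mem_toeplitzAlgebra (m n : ℤ) : proj α β m n ∈ toeplitzAlgebra α β :=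
  mul_mem (T_mem_toeplitzAlgebra m n) (T_mem_toeplitzAlgebra (-m) (-n))

theorem A_mem_toeplitzAlgebra : A α β ∈ toeplitzAlgebra α β :=
  add_mem (add_mem (proj_mem_toeplitzAlgebra _ _)
    (mul_mem (T_mem_toeplitzAlgebra _ _) (sub_mem (one_mem _) (proj_mem_toeplitzAlgebra _ _))))
    (mul_mem (T_mem_toeplitzAlgebra _ _)
      (sub_mem (proj_mem_toeplitzAlgebra _ _) (proj_mem_toeplitzAlgebra _ _)))

/-- The algebraic two-sided ideal generated by the commutators of the Toeplitz algebra. -/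
def commutatorSpan (α β : ℝ) : TwoSidedIdeal (toeplitzAlgebra α β) :=
  TwoSidedIdeal.span
    {S : toeplitzAlgebra α β | ∃ X Y : toeplitzAlgebra α β, S = X * Y - Y * X}

/-- `P M_{m,n} P` as an element of the Toeplitz algebra. -/
def toeplitz (α β : ℝ) (m n : ℤ) : toeplitzAlgebra α β := ⟨T α β m n, T_mem_toeplitzAlgebra m n⟩

/-- `𝒫_{m,n}` as an element of the Toeplitz algebra. -/
def toeplitzProj (α β : ℝ) (m n : ℤ) : toeplitzAlgebra α β :=
  toeplitz α β m n * toeplitz α β (-m) (-n)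

/-- The commutator of `T_{-m,-n}` and `T_{m,n}` is `𝒫_{-m,-n} - 𝒫_{m,n}`. Under the hypothesis it is
the identity on the range of `1 - 𝒫_{m,n}`, so `1 - 𝒫_{m,n}` equals its own product with that
commutator. -/
theorem one_sub_toeplitzProj_mem {m n : ℤ}
    (h : ∀ x y : ℤ, (x, y) ∈ corner α β → (x - m, y - n) ∉ corner α β →
      (x + m, y + n) ∈ corner α β) :
    1 - toeplitzProj α β m n ∈ commutatorSpan α β := by
  classical
  have hc : toeplitz α β (-m) (-n) * toeplitz α β m n - toeplitz α β m n * toeplitz α β (-m) (-n)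
      ∈ commutatorSpan α β := TwoSidedIdeal.subset_span ⟨_, _, rfl⟩
  have heq : 1 - toeplitzProj α β m n = (1 - toeplitzProj α β m n) *
      (toeplitz α β (-m) (-n) * toeplitz α β m n
        - toeplitz α β m n * toeplitz α β (-m) (-n)) := by
    refine Subtype.ext ?_
    change 1 - proj α β m n =
      (1 - proj α β m n) * (T α β (-m) (-n) * T α β m n - proj α β m n)
    have hp : T α β (-m) (-n) * T α β m n = proj α β (-m) (-n) := by
      rw [proj, neg_neg, neg_neg]
    rw [hp]
    refine ContinuousLinearMap.ext fun f => ext_corner fun ⟨x, y⟩ hxy => ?_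
    change _ = coord (x, y) ((1 - proj α β m n)
      (proj α β (-m) (-n) f - proj α β m n f) : H)
    rw [coord_one_sub_proj, coord_one_sub_proj, coord_sub, coord_proj, coord_proj]
    by_cases h' : (x - m, y - n) ∈ corner α β
    · simp [h']
    · simp [hxy, h', h x y hxy h']
  rw [heq]
  exact TwoSidedIdeal.mul_mem_left _ _ _ hc

theorem A_sub_one_mem_commutatorIdeal (hα : 0 < α) (hβ : 1 ≤ β) :
    (⟨A α β, A_mem_toeplitzAlgebra⟩ - 1 : toeplitzAlgebra α β) ∈ commutatorIdeal α β := by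
  refine subset_closure ?_
  change _ ∈ commutatorSpan α β
  have h₁ : 1 - toeplitzProj α β (-1) 0 ∈ commutatorSpan α β :=
    one_sub_toeplitzProj_mem fun x y h h' => by
      simpa [← sub_eq_add_neg] using sub_one_left_mem (β := β) hα
        (above_of_add_one_left_notMem hβ h (by simpa using h'))
  have h₂ : 1 - toeplitzProj α β 0 1 ∈ commutatorSpan α β :=
    one_sub_toeplitzProj_mem fun x y h h' => by
      simpa using add_one_right_mem (β := β)
        (above_of_sub_one_right_notMem h (by simpa using h'))
  -- Everything is expressed through the complements `1 - 𝒫`, so membership holds already in the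
  -- algebraic ideal, before closure.
  have heq : (⟨A α β, A_mem_toeplitzAlgebra⟩ - 1 : toeplitzAlgebra α β) =
      toeplitz α β 1 1 * (1 - toeplitzProj α β (-1) 0)
        + toeplitz α β 1 0 * ((1 - toeplitzProj α β 0 1) - (1 - toeplitzProj α β (-1) 0))
        - (1 - toeplitzProj α β 0 1) := by
    have hA : (⟨A α β, A_mem_toeplitzAlgebra⟩ : toeplitzAlgebra α β) =
        toeplitzProj α β 0 1 + toeplitz α β 1 1 * (1 - toeplitzProj α β (-1) 0)
          + toeplitz α β 1 0 * (toeplitzProj α β (-1) 0 - toeplitzProj α β 0 1) := rfl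
    rw [hA]
    simp only [mul_sub, mul_one]
    abel
  rw [heq]
  exact TwoSidedIdeal.sub_mem _ (TwoSidedIdeal.add_mem _ (TwoSidedIdeal.mul_mem_left _ _ _ h₁)
    (TwoSidedIdeal.mul_mem_left _ _ _ (TwoSidedIdeal.sub_mem _ h₂ h₁))) h₂

end CommutatorIdeal

theorem exists_isDoublePoint_iff {α β : ℝ} (hα : 0 < α) (hα' : α ≤ 1 / 2) (hβ : 1 ≤ β) :
    ∃ u v : ℤ, ∀ q, IsDoublePoint α β q ↔ q = (u, v) := by
  rcases hβ.eq_or_lt with rfl | hβ'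
  · rcases hα'.eq_or_lt with rfl | hα''
    · exact ⟨_, _, isDoublePoint_half_one_iff⟩
    · exact ⟨_, _, isDoublePoint_one_iff_of_lt hα hα''⟩
  · exact ⟨_, _, isDoublePoint_iff_of_lt hα hα' hβ'⟩

end ConcaveCorner

end

theorem theorem3p1 (α β : ℝ) (hα_pos : 0 < α) (hα_le : α ≤ 1 / 2) (hβ : 1 ≤ β) :
    -- no compression is needed in the formula that defines the operator
    (∀ f : ConcaveCorner.cornerSpace α β,
      (ConcaveCorner.A α β f : ConcaveCorner.H) =
        (ConcaveCorner.proj α β 0 1 f : ConcaveCorner.H)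
        + ConcaveCorner.M 1 1 ((1 - ConcaveCorner.proj α β (-1) 0) f : ConcaveCorner.H)
        + ConcaveCorner.M 1 0
            ((ConcaveCorner.proj α β (-1) 0 - ConcaveCorner.proj α β 0 1) f : ConcaveCorner.H)) ∧
    Function.Surjective (ConcaveCorner.A α β) ∧
    (ConcaveCorner.A α β).IsFredholm ∧
    ConcaveCorner.index (ConcaveCorner.A α β) = 1 ∧
    (α = 1 / 2 → β = 1 → ConcaveCorner.kernel (ConcaveCorner.A α β) =
      Submodule.span ℂ {ConcaveCorner.e (-3) (-1) - ConcaveCorner.e (-2) (-1)}) ∧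
    (α < 1 / 2 → β = 1 → ConcaveCorner.kernel (ConcaveCorner.A α β) =
      Submodule.span ℂ {ConcaveCorner.e (-2) 0 - ConcaveCorner.e (-1) 0}) ∧
    (α = 1 / 2 → 1 < β → ConcaveCorner.kernel (ConcaveCorner.A α β) =
      Submodule.span ℂ {ConcaveCorner.e (-1) 0 - ConcaveCorner.e 0 0}) ∧
    (α < 1 / 2 → 1 < β → ConcaveCorner.kernel (ConcaveCorner.A α β) =
      Submodule.span ℂ {ConcaveCorner.e (-1) 0 - ConcaveCorner.e 0 0}) ∧
    (∃ hA : ConcaveCorner.A α β ∈ ConcaveCorner.toeplitzAlgebra α β,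
      (⟨ConcaveCorner.A α β, hA⟩ - 1 : ConcaveCorner.toeplitzAlgebra α β) ∈
        ConcaveCorner.commutatorIdeal α β) := by
  obtain ⟨u, v, hq⟩ := ConcaveCorner.exists_isDoublePoint_iff hα_pos hα_le hβ
  have hsurj := ConcaveCorner.surjective_A hα_pos hα_le hβ hq
  have hker := ConcaveCorner.finrank_ker_A hα_pos hα_le hβ hq
  refine ⟨ConcaveCorner.A_apply_eq_translations hα_pos hα_le hβ, hsurj,
    ConcaveCorner.isFredholm_of_surjective hsurj (Module.finite_of_finrank_eq_succ hker), ?_,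
    ?_, ?_, ?_, ?_, ConcaveCorner.A_mem_toeplitzAlgebra,
    ConcaveCorner.A_sub_one_mem_commutatorIdeal hα_pos hβ⟩
  · rw [ConcaveCorner.index_of_surjective hsurj, hker]
    rfl
  · rintro rfl rfl
    have h := ConcaveCorner.kernel_A hα_pos hα_le hβ ConcaveCorner.isDoublePoint_half_one_iff
    rwa [show (-2 - 1 : ℤ) = -3 by norm_num] at h
  · rintro h rfl
    have h' := ConcaveCorner.kernel_A hα_pos hα_le hβ
      (ConcaveCorner.isDoublePoint_one_iff_of_lt hα_pos h)
    rwa [show (-1 - 1 : ℤ) = -2 by norm_num] at h'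
  · rintro - h
    have h' := ConcaveCorner.kernel_A hα_pos hα_le hβ
      (ConcaveCorner.isDoublePoint_iff_of_lt hα_pos hα_le h)
    rwa [show (0 - 1 : ℤ) = -1 by norm_num] at h'
  · rintro - h
    have h' := ConcaveCorner.kernel_A hα_pos hα_le hβ
      (ConcaveCorner.isDoublePoint_iff_of_lt hα_pos hα_le h)
    rwa [show (0 - 1 : ℤ) = -1 by norm_num] at h'
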